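/- Let $k$ be a field of characteristic zero and let $\mathcal U$ be a cocommutative Hopf algebra over $k$, with coproduct $\Delta$ and antipode $S$. Let $\mathfrak g=\{x\in\mathcal U:\Delta x=x\otimes 1+1\otimes x\}$ be the Lie algebra of its primitive elements, with bracket $[x,y]=xy-yx$. Let $\mathcal U(\mathfrak g)$ be the universal enveloping algebra of $\mathfrak g$ with its usual Hopf algebra structure, in which the elements of $\mathfrak g$ are primitive. **Filtered case.** Suppose that $\mathcal U$ is a connected filtered Hopf algebra, that is, it carries an increasing filtration $\mathcal U^0\subset\mathcal U^1\subset\cdots$ by subspaces with $\bigcup_n\mathcal U^n=\mathcal U$, $\mathcal U^p\,\mathcal U^q\subset\mathcal U^{p+q}$, $\Delta(\mathcal U^n)\subset\sum_{p+q=n}\mathcal U^p\otimes\mathcal U^q$, $S(\mathcal U^n)\subset\mathcal U^n$ and $\dim\mathcal U^0=1$. Give $\mathfrak g$ the induced filtration $\mathfrak g^n=\mathfrak g\cap\mathcal U^n$ and $\mathcal U(\mathfrak g)$ the filtration induced by it: $\mathcal U(\mathfrak g)^n$ is spanned by the products $x_1\cdots x_r$ ($r\ge 0$) with $x_i\in\mathfrak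 g^{d_i}$ and $d_1+\cdots+d_r\le n$. Then $\mathcal U(\mathfrak g)$ is a filtered Hopf algebra, and there is an isomorphism of filtered Hopf algebras $\mathcal U(\mathfrak g)\to\mathcal U$ (an isomorphism of Hopf algebras that maps $\mathcal U(\mathfrak g)^n$ onto $\mathcal U^n$ for every $n$) which restricts to the inclusion $\mathfrak g\hookrightarrow\mathcal U$. **Graded case.** Suppose that $\mathcal U$ is a connected graded Hopf algebra, that is, $\mathcal U=\bigoplus_{n\ge 0}\mathcal U_n$ with $\mathcal U_p\,\mathcal U_q\subset\mathcal U_{p+q}$, $\Delta(\mathcal U_n)\subset\bigoplus_{p+q=n}\mathcal U_p\otimes\mathcal U_q$ and $\dim\mathcal U_0=1$. Let $\mathfrak g_n=\mathfrak g\cap\mathcal U_n$, and let $\mathcal U(\mathfrak g)_n$ be spanned by the products $x_1\cdots x_r$ ($r\ge 0$) with $x_i\in\mathfrak g_{d_i}$ and $d_1+\cdots+d_r=n$. Then $\mathcal U(\mathfrak g)$ with the subspaces $\mathcal U(\mathfrak g)_n$ is a graded Hopf algebra, and there is an isomorphism of graded Hopf algebras $\mathcal U(\mathfrak g)\to\mathcal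 U$ (an isomorphism of Hopf algebras that maps $\mathcal U(\mathfrak g)_n$ onto $\mathcal U_n$ for every $n$) which restricts to the inclusion $\mathfrak g\hookrightarrow\mathcal U$. -/

import Mathlib

open scoped TensorProduct

attribute [local instance 100] LieRing.ofAssociativeRing

noncomputable section

namespace UniversalEnvelopingAlgebra

variable (k : Type*) [Field k] {L : Type*} [LieRing L] [LieAlgebra k L]

/-! ### The standard Hopf algebra structure of an enveloping algebra -/

/-- A linear map `f : L → A` with `f [x, y] = f x * f y - f y * f x` extends to an algebra
morphism on the enveloping algebra. -/
def liftOfBracket {A : Type*} [Ring A] [Algebra k A] (f : L →ₗ[k] A)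
    (hf : ∀ x y : L, f ⁅x, y⁆ = f x * f y - f y * f x) :
    UniversalEnvelopingAlgebra k L →ₐ[k] A :=
  lift k { f with map_lie' := fun {x y} => hf x y }

theorem liftOfBracket_ι {A : Type*} [Ring A] [Algebra k A] (f : L →ₗ[k] A)
    (hf : ∀ x y : L, f ⁅x, y⁆ = f x * f y - f y * f x) (x : L) :
    liftOfBracket k f hf (ι k x) = f x :=
  lift_ι_apply k _ x

theorem algHom_ext_ι {A : Type*} [Ring A] [Algebra k A]
    {f g : UniversalEnvelopingAlgebra k L →ₐ[k] A} (h : ∀ x : L, f (ι k x) = g (ι k x)) :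
    f = g := by
  apply hom_ext
  ext x
  exact h x

theorem ι_bracket (x y : L) :
    ι k ⁅x, y⁆ = ι k x * ι k y - ι k y * ι k x := by
  rw [LieHom.map_lie, LieRing.of_associative_ring_bracket]

variable (L) in
/-- The coproduct: the algebra morphism with `x ↦ x ⊗ 1 + 1 ⊗ x` for `x` in `L`. -/
def comulHom : UniversalEnvelopingAlgebra k L →ₐ[k]
    UniversalEnvelopingAlgebra k L ⊗[k] UniversalEnvelopingAlgebra k L :=
  liftOfBracket k
    ((TensorProduct.mk k _ _).flip 1 ∘ₗ (ι k : L →ₗ⁅k⁆ _).toLinearMap +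
      TensorProduct.mk k _ _ 1 ∘ₗ (ι k : L →ₗ⁅k⁆ _).toLinearMap)
    (fun x y => by
      simp only [LinearMap.add_apply, LinearMap.comp_apply, LinearMap.flip_apply,
        TensorProduct.mk_apply, LieHom.coe_toLinearMap, ι_bracket, TensorProduct.sub_tmul,
        TensorProduct.tmul_sub, mul_add, add_mul, Algebra.TensorProduct.tmul_mul_tmul, one_mul,
        mul_one]
      abel)

theorem comulHom_ι (x : L) : comulHom k L (ι k x) = ι k x ⊗ₜ[k] 1 + 1 ⊗ₜ[k] ι k x :=
  liftOfBracket_ι k _ _ x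

variable (L) in
/-- The counit: the algebra morphism vanishing on `L`. -/
def counitHom : UniversalEnvelopingAlgebra k L →ₐ[k] k :=
  liftOfBracket k 0 (fun x y => by simp)

theorem counitHom_ι (x : L) : counitHom k L (ι k x) = 0 :=
  liftOfBracket_ι k _ _ x

variable (L) in
/-- The antipode, as an algebra morphism to the opposite algebra: it sends `x` in `L` to `-x`. -/
def antipodeHom : UniversalEnvelopingAlgebra k L →ₐ[k] (UniversalEnvelopingAlgebra k L)ᵐᵒᵖ :=
  liftOfBracket k
    (-((MulOpposite.opLinearEquiv k).toLinearMap ∘ₗ (ι k : L →ₗ⁅k⁆ _).toLinearMap))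
    (fun x y => by
      simp only [LinearMap.neg_apply, LinearMap.comp_apply, LieHom.coe_toLinearMap, ι_bracket,
        LinearEquiv.coe_coe, MulOpposite.coe_opLinearEquiv, MulOpposite.op_sub, MulOpposite.op_mul,
        neg_mul_neg]
      abel)

theorem antipodeHom_ι (x : L) :
    antipodeHom k L (ι k x) = -MulOpposite.op (ι k x) :=
  liftOfBracket_ι k _ _ x

instance instBialgebra : Bialgebra k (UniversalEnvelopingAlgebra k L) :=
  .ofAlgHom (comulHom k L) (counitHom k L)
    (algHom_ext_ι k fun x => by
      simp [-ι_apply, comulHom_ι, Algebra.TensorProduct.one_def, TensorProduct.add_tmul,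
        TensorProduct.tmul_add]
      abel)
    (algHom_ext_ι k fun x => by simp [-ι_apply, comulHom_ι, counitHom_ι])
    (algHom_ext_ι k fun x => by simp [-ι_apply, comulHom_ι, counitHom_ι])

variable (L) in
/-- The antipode as a linear endomorphism. -/
def antipodeLin : UniversalEnvelopingAlgebra k L →ₗ[k] UniversalEnvelopingAlgebra k L :=
  (MulOpposite.opLinearEquiv k).symm.toLinearMap ∘ₗ (antipodeHom k L).toLinearMap

theorem antipodeLin_ι (x : L) : antipodeLin k L (ι k x) = -ι k x := by
  simp [-ι_apply, antipodeLin, antipodeHom_ι]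

theorem antipodeLin_mul (a b : UniversalEnvelopingAlgebra k L) :
    antipodeLin k L (a * b) = antipodeLin k L b * antipodeLin k L a := by
  simp [antipodeLin]

theorem antipodeLin_algebraMap (c : k) :
    antipodeLin k L (algebraMap k _ c) = algebraMap k _ c := by
  simp [antipodeLin]

theorem induction_ι {P : UniversalEnvelopingAlgebra k L → Prop}
    (algebraMap : ∀ c, P (algebraMap k _ c)) (ι : ∀ x, P (ι k x))
    (mul : ∀ a b, P a → P b → P (a * b)) (add : ∀ a b, P a → P b → P (a + b))
    (a : UniversalEnvelopingAlgebra k L) : P a := by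
  let S : Subalgebra k (UniversalEnvelopingAlgebra k L) :=
    { carrier := {a | P a}
      mul_mem' := fun {a b} ha hb => mul a b ha hb
      add_mem' := fun {a b} ha hb => add a b ha hb
      algebraMap_mem' := algebraMap }
  let g : L →ₗ[k] S := LinearMap.codRestrict S.toSubmodule
    (UniversalEnvelopingAlgebra.ι k : L →ₗ⁅k⁆ _).toLinearMap ι
  have hg : ∀ x y : L, g ⁅x, y⁆ = g x * g y - g y * g x := fun x y =>
    Subtype.ext (ι_bracket k x y)
  let f : UniversalEnvelopingAlgebra k L →ₐ[k] S := liftOfBracket k g hg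
  have h : S.val.comp f = AlgHom.id k _ := algHom_ext_ι k fun x =>
    congrArg Subtype.val (liftOfBracket_ι k g hg x)
  have := DFunLike.congr_fun h a
  rw [AlgHom.id_apply] at this
  rw [← this]
  exact (f a).2

instance instHopfAlgebra : HopfAlgebra k (UniversalEnvelopingAlgebra k L) where
  antipode := antipodeLin k L
  mul_antipode_rTensor_comul := by
    set f : UniversalEnvelopingAlgebra k L ⊗[k] UniversalEnvelopingAlgebra k L →ₗ[k]
      UniversalEnvelopingAlgebra k L :=
      LinearMap.mul' k _ ∘ₗ (antipodeLin k L).rTensor _ with hf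
    have key : ∀ T w₁ w₂, f (T * (w₁ ⊗ₜ[k] w₂)) = antipodeLin k L w₁ * f T * w₂ := by
      intro T w₁ w₂
      induction T with
      | zero => simp
      | tmul a b => simp [hf, antipodeLin_mul, mul_assoc]
      | add a b ha hb => simp only [add_mul, map_add, ha, hb, mul_add]
    ext a
    change f (comulHom k L a) = algebraMap k _ (counitHom k L a)
    induction a using induction_ι k with
    | algebraMap c =>
      rw [AlgHom.commutes, AlgHom.commutes, Algebra.TensorProduct.algebraMap_apply]
      simp [hf, antipodeLin_algebraMap]
    | ι x =>
      rw [comulHom_ι, counitHom_ι]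
      have h1 : antipodeLin k L 1 = 1 := by simpa using antipodeLin_algebraMap k (L := L) 1
      simp [-ι_apply, hf, antipodeLin_ι, h1]
    | add a b ha hb => simp only [map_add, ha, hb]
    | mul a b ha hb =>
      have : ∀ W, f (comulHom k L a * W) = algebraMap k _ (counitHom k L a) * f W := by
        intro W
        induction W with
        | zero => simp
        | tmul w₁ w₂ =>
          rw [key, ha, ← Algebra.commutes, mul_assoc]
          simp [hf]
        | add p q hp hq => simp only [mul_add, map_add, hp, hq]
      rw [map_mul, this, hb, map_mul, map_mul]
  mul_antipode_lTensor_comul := by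
    set f : UniversalEnvelopingAlgebra k L ⊗[k] UniversalEnvelopingAlgebra k L →ₗ[k]
      UniversalEnvelopingAlgebra k L :=
      LinearMap.mul' k _ ∘ₗ (antipodeLin k L).lTensor _ with hf
    have key : ∀ T w₁ w₂, f ((w₁ ⊗ₜ[k] w₂) * T) = w₁ * f T * antipodeLin k L w₂ := by
      intro T w₁ w₂
      induction T with
      | zero => simp
      | tmul a b => simp [hf, antipodeLin_mul, mul_assoc]
      | add a b ha hb => simp only [add_mul, map_add, ha, hb, mul_add]
    ext a
    change f (comulHom k L a) = algebraMap k _ (counitHom k L a)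
    induction a using induction_ι k with
    | algebraMap c =>
      rw [AlgHom.commutes, AlgHom.commutes, Algebra.TensorProduct.algebraMap_apply]
      have h1 : antipodeLin k L 1 = 1 := by simpa using antipodeLin_algebraMap k (L := L) 1
      simp [hf, h1]
    | ι x =>
      rw [comulHom_ι, counitHom_ι]
      have h1 : antipodeLin k L 1 = 1 := by simpa using antipodeLin_algebraMap k (L := L) 1
      simp [-ι_apply, hf, antipodeLin_ι, h1]
    | add a b ha hb => simp only [map_add, ha, hb]
    | mul a b ha hb =>
      have : ∀ W, f (W * comulHom k L b) = f W * algebraMap k _ (counitHom k L b) := by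
        intro W
        induction W with
        | zero => simp
        | tmul w₁ w₂ =>
          rw [key, hb, mul_assoc, Algebra.commutes, ← mul_assoc]
          simp [hf]
        | add p q hp hq => simp only [add_mul, map_add, hp, hq]
      rw [map_mul, this, ha, map_mul, map_mul]

theorem comul_ι (x : L) :
    Coalgebra.comul (R := k) (ι k x) = ι k x ⊗ₜ[k] 1 + 1 ⊗ₜ[k] ι k x :=
  comulHom_ι k x

theorem counit_ι (x : L) : Coalgebra.counit (R := k) (ι k x) = 0 :=
  counitHom_ι k x

theorem antipode_ι (x : L) : HopfAlgebra.antipode k (ι k x) = -ι k x :=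
  antipodeLin_ι k x

/-! ### Filtrations and gradings induced on the enveloping algebra -/

/-- The filtration of the enveloping algebra induced by a filtration `G` of the Lie algebra: the
`n`-th piece is spanned by the products `x₁ ⋯ xᵣ` (`r ≥ 0`) with `xᵢ ∈ G dᵢ` and
`d₁ + ⋯ + dᵣ ≤ n`. -/
def inducedFiltration (G : ℕ → Submodule k L) (n : ℕ) :
    Submodule k (UniversalEnvelopingAlgebra k L) :=
  Submodule.span k {a | ∃ l : List (ℕ × L), (∀ p ∈ l, p.2 ∈ G p.1) ∧
    (l.map Prod.fst).sum ≤ n ∧ a = (l.map fun p => ι k p.2).prod}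

/-- The grading of the enveloping algebra induced by a grading `G` of the Lie algebra: the
`n`-th piece is spanned by the products `x₁ ⋯ xᵣ` (`r ≥ 0`) with `xᵢ ∈ G dᵢ` and
`d₁ + ⋯ + dᵣ = n`. -/
def inducedGrading (G : ℕ → Submodule k L) (n : ℕ) :
    Submodule k (UniversalEnvelopingAlgebra k L) :=
  Submodule.span k {a | ∃ l : List (ℕ × L), (∀ p ∈ l, p.2 ∈ G p.1) ∧
    (l.map Prod.fst).sum = n ∧ a = (l.map fun p => ι k p.2).prod}

end UniversalEnvelopingAlgebra

namespace HopfAlgebra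

variable (k : Type*) [Field k] {H : Type*} [Ring H] [HopfAlgebra k H]

/-- The image of `V ⊗ W` in `H ⊗ H`, for subspaces `V` and `W` of `H`. -/
def tensorSubmodule (V W : Submodule k H) : Submodule k (H ⊗[k] H) :=
  LinearMap.range (TensorProduct.mapIncl V W)

/-- `F` is an increasing exhaustive filtration making the Hopf algebra `H` a filtered Hopf
algebra. -/
structure IsFiltered (F : ℕ → Submodule k H) : Prop where
  mono : Monotone F
  exhaustive : ∀ x : H, ∃ n, x ∈ F n
  mul_mem : ∀ p q : ℕ, ∀ x ∈ F p, ∀ y ∈ F q, x * y ∈ F (p + q)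
  comul_mem : ∀ n : ℕ, ∀ x ∈ F n, Coalgebra.comul (R := k) x ∈
    ⨆ pq ∈ Finset.HasAntidiagonal.antidiagonal n, tensorSubmodule k (F pq.1) (F pq.2)
  antipode_mem : ∀ n : ℕ, ∀ x ∈ F n, antipode k x ∈ F n

/-- `𝒜` is a direct sum decomposition making the Hopf algebra `H` a graded Hopf algebra. -/
structure IsGraded (𝒜 : ℕ → Submodule k H) : Prop where
  isInternal : DirectSum.IsInternal 𝒜
  mul_mem : ∀ p q : ℕ, ∀ x ∈ 𝒜 p, ∀ y ∈ 𝒜 q, x * y ∈ 𝒜 (p + q)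
  comul_mem : ∀ n : ℕ, ∀ x ∈ 𝒜 n, Coalgebra.comul (R := k) x ∈
    ⨆ pq ∈ Finset.HasAntidiagonal.antidiagonal n, tensorSubmodule k (𝒜 pq.1) (𝒜 pq.2)

variable (H) in
/-- The Lie algebra of primitive elements of `H`, with the commutator bracket. -/
def primitives : LieSubalgebra k H where
  carrier := {x | Coalgebra.comul (R := k) x = x ⊗ₜ[k] 1 + 1 ⊗ₜ[k] x}
  zero_mem' := by simp
  add_mem' := by
    intro x y hx hy
    simp only [Set.mem_ofPred_eq] at *
    rw [map_add, hx, hy, TensorProduct.add_tmul, TensorProduct.tmul_add]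
    abel
  smul_mem' := by
    intro c x hx
    simp only [Set.mem_ofPred_eq] at *
    rw [map_smul, hx, smul_add, TensorProduct.smul_tmul', TensorProduct.tmul_smul]
  lie_mem' := by
    intro x y hx hy
    change Coalgebra.comul (R := k) x = _ at hx
    change Coalgebra.comul (R := k) y = _ at hy
    change Coalgebra.comul (R := k) ⁅x, y⁆ = ⁅x, y⁆ ⊗ₜ[k] 1 + 1 ⊗ₜ[k] ⁅x, y⁆
    simp only [LieRing.of_associative_ring_bracket, map_sub, Bialgebra.comul_mul, hx, hy,
      TensorProduct.sub_tmul, TensorProduct.tmul_sub, mul_add, add_mul,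
      Algebra.TensorProduct.tmul_mul_tmul, one_mul, mul_one]
    abel

/-- The family of subspaces `g ∩ F n` of the Lie algebra `g` of primitive elements: the filtration
(or grading) of `g` induced by the filtration (or grading) `F` of `H`. -/
def primitivePart (F : ℕ → Submodule k H) (n : ℕ) : Submodule k (primitives k H) :=
  (F n).comap (primitives k H).toSubmodule.subtype

end HopfAlgebra

end

/-! The proof uses the Adams operations Ψ^m = id^{*m}, the convolution powers of the identity. With
J = id - ηε one has Ψ^m = Σ_i (m choose i) J^{*i}. On the n-th piece of a connected family J^{*i}
vanishes for i > n, so Ψ^m x is a polynomial in m. Its coefficients are the Eulerian operators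
e_j(x). Evaluation at m = 1 gives x = Σ_j e_j(x), evaluation at m = 0 gives e_0 = ηε, and Ψ^{a+b} =
Ψ^a * Ψ^b gives (j+1) e_{j+1} = e_1 * e_j (`eulerian_succ`). So everything is governed by e_1, the
convolution logarithm of the identity.

Cocommutativity makes each Ψ^m a coalgebra map, hence e_1 takes primitive values
(`comul_eulerian_one`). On 𝒰(𝔤) the powers of elements of 𝔤 span (`span_pow_eq_top`) and Ψ^m(x^n) =
m^n x^n. Thus polynomiality holds there too, and e_1 maps 𝒰(𝔤) into the image of 𝔤.

The canonical morphism φ : 𝒰(𝔤) → 𝒰 is a bialgebra map, so it commutes with the e_j. On 𝒰(𝔤), e_1 =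
χ_1 ∘ φ, where χ_1 is e_1 of 𝒰 followed by 𝔤 → 𝒰(𝔤). The recursion propagates this to maps χ_j with
e_j = χ_j ∘ φ on 𝒰(𝔤) and φ ∘ χ_j = e_j on 𝒰 (`exists_eulerian_factor`). If φ(a) = 0, then a = Σ
e_j(a) = 0; and any x equals φ(Σ χ_j(x)). The Poincaré–Birkhoff–Witt theorem is not needed.

Each Ψ^m with m ≥ 1 preserves the given pieces, hence so do its coefficients. So χ_j sends the n-th
piece of 𝒰 into the n-th piece of 𝒰(𝔤), and φ matches the pieces exactly. The filtered or graded
structure of 𝒰(𝔤) is then transported back along φ. -/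

namespace Polynomial

/-! ### Polynomials over a noncommutative algebra and their values at natural numbers -/

variable (k : Type*) [Field k] {A : Type*} [Ring A] [Algebra k A]

/-- Evaluation at a natural number, as an algebra morphism; the coefficients need not commute. -/
noncomputable def natEval (m : ℕ) : A[X] →ₐ[k] A where
  __ := eval₂RingHom' (RingHom.id A) (m : A) fun a => (Nat.cast_commute m a).symm
  commutes' c := by
    change eval₂ (RingHom.id A) (m : A) (algebraMap k A[X] c) = _
    rw [algebraMap_apply, eval₂_C, RingHom.id_apply]

theorem natEval_apply (m : ℕ) (P : A[X]) : natEval k m P = eval (m : A) P := rfl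

@[simp] theorem natEval_C (m : ℕ) (a : A) : natEval k m (C a) = a := by simp [natEval_apply]

@[simp] theorem natEval_X (m : ℕ) : natEval k m (X : A[X]) = m := by simp [natEval_apply]

@[simp] theorem natEval_monomial (m n : ℕ) (a : A) :
    natEval k m (monomial n a) = (m : k) ^ n • a := by
  rw [natEval_apply, eval_monomial, Algebra.smul_def, map_pow, map_natCast,
    ((Nat.cast_commute m _).pow_left n).eq]

theorem natEval_eq_sum (m : ℕ) (P : A[X]) :
    natEval k m P = ∑ i ∈ P.support, (m : k) ^ i • P.coeff i := by
  rw [natEval_apply, eval_eq_sum, sum_def]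
  refine Finset.sum_congr rfl fun i _ => ?_
  rw [Algebra.smul_def, map_pow, map_natCast, ((Nat.cast_commute m _).pow_left i).eq]

theorem natEval_taylor (a b : ℕ) (P : A[X]) :
    natEval k a (taylor (b : A) P) = natEval k (a + b) P := by
  induction P using Polynomial.induction_on' with
  | add p q hp hq => simp only [map_add, hp, hq]
  | monomial n c =>
    rw [taylor_monomial, ← C_mul_X_pow_eq_monomial]
    simp

theorem natEval_map {B : Type*} [Ring B] [Algebra k B] (f : A →ₐ[k] B) (m : ℕ) (P : A[X]) :
    natEval k m (mapAlgHom f P) = f (natEval k m P) := by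
  induction P using Polynomial.induction_on' with
  | add p q hp hq => simp only [map_add, hp, hq]
  | monomial n c =>
    rw [← C_mul_X_pow_eq_monomial]
    simp

variable {k} [CharZero k]

/-- A polynomial whose values at the positive integers lie in a subspace has its coefficients in
that subspace. -/
theorem coeff_mem_of_natEval_mem (V : Submodule k A) (P : A[X])
    (h : ∀ m, 1 ≤ m → natEval k m P ∈ V) (i : ℕ) : P.coeff i ∈ V := by
  by_contra hi
  obtain ⟨f, hf, hV⟩ := Submodule.exists_le_ker_of_notMem hi
  -- A functional that kills `V` but not the `i`-th coefficient turns `P` into a scalar polynomial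
  -- with infinitely many roots.
  let q : k[X] := ∑ j ∈ P.support, monomial j (f (P.coeff j))
  have hq : q = 0 := by
    refine eq_zero_of_infinite_isRoot q (Set.Infinite.mono (s := Nat.cast '' Set.Ici 1) ?_
      ((Set.Ici_infinite 1).image Nat.cast_injective.injOn))
    rintro _ ⟨m, hm, rfl⟩
    have h0 : f (natEval k m P) = 0 := hV (h m hm)
    rw [natEval_eq_sum, map_sum] at h0
    change eval (m : k) q = 0
    rw [← h0, eval_finsetSum]
    refine Finset.sum_congr rfl fun j _ => ?_
    rw [eval_monomial, map_smul, smul_eq_mul, mul_comm]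
  have hc : q.coeff i = f (P.coeff i) := by
    simp only [q, finsetSum_coeff, coeff_monomial, Finset.sum_ite_eq', mem_support_iff]
    split_ifs with h0
    · rfl
    · rw [notMem_support_iff.mp h0, map_zero]
  exact hf (by rw [← hc, hq, coeff_zero])

theorem natEval_injective {P Q : A[X]} (h : ∀ m, 1 ≤ m → natEval k m P = natEval k m Q) :
    P = Q := by
  rw [← sub_eq_zero]
  ext i
  have := coeff_mem_of_natEval_mem (⊥ : Submodule k A) (P - Q)
    (fun m hm => by rw [map_sub, h m hm, sub_self]; exact zero_mem _) i
  rwa [Submodule.mem_bot] at this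

end Polynomial

/-! ### Adams operations and Eulerian operators -/

namespace AdamsOperation

open Polynomial WithConv LinearMap

variable (k : Type*) [Field k] {H : Type*} [Ring H] [Bialgebra k H]

variable (H) in
/-- The Adams operation: the `m`-th convolution power of the identity. -/
noncomputable def adams (m : ℕ) : H →ₗ[k] H :=
  (toConv (LinearMap.id : H →ₗ[k] H) ^ m).ofConv

theorem adams_zero (x : H) :
    adams k H 0 x = algebraMap k H (Coalgebra.counit (R := k) x) := by
  rw [adams, pow_zero, convOne_apply]

theorem adams_one (x : H) : adams k H 1 x = x := by
  rw [adams, pow_one]; rfl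

theorem adams_add (m n : ℕ) (x : H) : adams k H (m + n) x =
    mul' k H (TensorProduct.map (adams k H m) (adams k H n) (Coalgebra.comul x)) := by
  rw [adams, pow_add, convMul_apply]; rfl

theorem adams_succ (m : ℕ) (x : H) : adams k H (m + 1) x =
    mul' k H (TensorProduct.map (adams k H m) LinearMap.id (Coalgebra.comul x)) := by
  rw [adams_add]
  congr 3
  ext; exact adams_one k _

/-- Bialgebra morphisms commute with the Adams operations. -/
theorem map_adams {K : Type*} [Ring K] [Bialgebra k K] (f : H →ₐc[k] K) (m : ℕ) (x : H) :
    f (adams k H m x) = adams k K m (f x) := by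
  have h := fun x => DFunLike.congr_fun (CoalgHomClass.map_comp_comul f) x
  have key : ∀ m, (f : H →ₐ[k] K).toLinearMap ∘ₗ adams k H m =
      adams k K m ∘ₗ (f : H →ₐ[k] K).toLinearMap := by
    intro m
    induction m with
    | zero =>
      ext x
      change f (adams k H 0 x) = adams k K 0 (f x)
      rw [adams_zero, adams_zero, AlgHomClass.commutes, CoalgHomClass.counit_comp_apply]
    | succ m ih =>
      have hc : (Coalgebra.comul ∘ₗ (f : H →ₐ[k] K).toLinearMap : H →ₗ[k] K ⊗[k] K) =
          TensorProduct.map (f : H →ₐ[k] K).toLinearMap (f : H →ₐ[k] K).toLinearMap ∘ₗ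
            Coalgebra.comul := by
        ext x; exact (h x).symm
      have hs : adams k H (m + 1) =
          mul' k H ∘ₗ TensorProduct.map (adams k H m) LinearMap.id ∘ₗ Coalgebra.comul := by
        ext x; exact adams_succ k m x
      have hs' : adams k K (m + 1) =
          mul' k K ∘ₗ TensorProduct.map (adams k K m) LinearMap.id ∘ₗ Coalgebra.comul := by
        ext x; exact adams_succ k m x
      rw [hs, hs', ← LinearMap.comp_assoc, AlgHom.comp_mul', LinearMap.comp_assoc,
        ← LinearMap.comp_assoc _ _ (TensorProduct.map _ _), ← TensorProduct.map_comp, ih,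
        LinearMap.comp_assoc, LinearMap.comp_assoc, hc,
        ← LinearMap.comp_assoc _ _ (TensorProduct.map _ _), ← TensorProduct.map_comp]
      rfl
  exact DFunLike.congr_fun (key m) x

variable (H) in
/-- Every orbit `m ↦ Ψ^m x` of the Adams operations is a polynomial in `m`. -/
def IsAdamsPolynomial : Prop :=
  ∀ x : H, ∃ P : H[X], ∀ m, natEval k m P = adams k H m x

/-- Evaluation at a natural number is multiplicative, because such a number is central. This lifts
convolution identities between Adams operations to identities of polynomials. -/
theorem natEval_mul'_map {C D : Type*} [AddCommGroup C] [Module k C] [AddCommGroup D] [Module k D]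
    (m : ℕ) (f : C →ₗ[k] H[X]) (g : D →ₗ[k] H[X]) (T : C ⊗[k] D) :
    natEval k m (mul' k H[X] (TensorProduct.map f g T)) =
      mul' k H (TensorProduct.map ((natEval k m).toLinearMap ∘ₗ f)
        ((natEval k m).toLinearMap ∘ₗ g) T) := by
  induction T with
  | zero => simp
  | tmul a b => simp
  | add a b ha hb => simp only [map_add, ha, hb]

variable {k} [CharZero k]

/-- The polynomial `P` with `P(m) = Ψ^m x`, as a linear function of `x`. -/
noncomputable def eulerianSeries (h : IsAdamsPolynomial k H) : H →ₗ[k] H[X] where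
  toFun x := (h x).choose
  map_add' x y := natEval_injective (k := k) fun m _ => by
    rw [map_add, (h x).choose_spec m, (h y).choose_spec, ← map_add]
    exact (h (x + y)).choose_spec m
  map_smul' c x := natEval_injective (k := k) fun m _ => by
    rw [map_smul, (h x).choose_spec, RingHom.id_apply, ← map_smul]
    exact (h (c • x)).choose_spec m

theorem natEval_eulerianSeries (h : IsAdamsPolynomial k H) (m : ℕ) (x : H) :
    natEval k m (eulerianSeries h x) = adams k H m x :=
  (h x).choose_spec m

/-- The Eulerian operators: the coefficients of the Adams operations. -/
noncomputable def eulerian (h : IsAdamsPolynomial k H) (i : ℕ) : H →ₗ[k] H :=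
  (lcoeff H i).restrictScalars k ∘ₗ eulerianSeries h

theorem eulerian_apply (h : IsAdamsPolynomial k H) (i : ℕ) (x : H) :
    eulerian h i x = (eulerianSeries h x).coeff i := rfl

theorem eulerian_zero (h : IsAdamsPolynomial k H) (x : H) :
    eulerian h 0 x = algebraMap k H (Coalgebra.counit (R := k) x) := by
  rw [← adams_zero, ← natEval_eulerianSeries h, eulerian_apply, natEval_apply, Nat.cast_zero,
    coeff_zero_eq_eval_zero]

/-- Evaluation at `m = 1`, where Ψ^1 is the identity. -/
theorem sum_eulerian (h : IsAdamsPolynomial k H) (x : H) :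
    ∑ i ∈ (eulerianSeries h x).support, eulerian h i x = x := by
  conv_rhs => rw [← adams_one k x, ← natEval_eulerianSeries h, natEval_eq_sum]
  simp [eulerian_apply]

/-- The value `m = 0` is left out because Ψ^0 = ηε need not preserve `V`; infinitely many values
suffice. -/
theorem eulerian_mem (h : IsAdamsPolynomial k H) (V : Submodule k H) {x : H}
    (hx : ∀ m, 1 ≤ m → adams k H m x ∈ V) (i : ℕ) : eulerian h i x ∈ V :=
  coeff_mem_of_natEval_mem V (eulerianSeries h x) (fun m hm => (natEval_eulerianSeries h m x).symm ▸ hx m hm) i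

theorem map_eulerian {K : Type*} [Ring K] [Bialgebra k K] (hH : IsAdamsPolynomial k H)
    (hK : IsAdamsPolynomial k K) (f : H →ₐc[k] K) (i : ℕ) (x : H) :
    f (eulerian hH i x) = eulerian hK i (f x) := by
  have : mapAlgHom (f : H →ₐ[k] K) (eulerianSeries hH x) = eulerianSeries hK (f x) :=
    natEval_injective (k := k) fun m _ => by
      rw [natEval_map, natEval_eulerianSeries, natEval_eulerianSeries, ← map_adams]
      rfl
  rw [eulerian_apply hK, ← this]
  simp [eulerian_apply]

/-- The recursion `(j + 1) e_{j+1} = e₁ * e_j` for the Eulerian operators. -/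
theorem eulerian_succ (h : IsAdamsPolynomial k H) (j : ℕ) (x : H) :
    ((j : k) + 1) • eulerian h (j + 1) x =
      mul' k H (TensorProduct.map (eulerian h 1) (eulerian h j) (Coalgebra.comul x)) := by
  have hE : ∀ m, (natEval k m).toLinearMap ∘ₗ eulerianSeries h = adams k H m := fun m => by
    ext x; exact natEval_eulerianSeries h m x
  let c : H →ₗ[k] H[X] := (CAlgHom : H →ₐ[k] H[X]).toLinearMap
  have hc : ∀ (f : H →ₗ[k] H) m, (natEval k m).toLinearMap ∘ₗ c ∘ₗ f = f := fun f m => by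
    ext x; simp [c]
  have h1 : ∀ b : ℕ, natEval k b (derivative (eulerianSeries h x)) =
      mul' k H (TensorProduct.map (eulerian h 1) (adams k H b) (Coalgebra.comul x)) := by
    intro b
    -- With `b` fixed, Ψ^{a+b} = Ψ^a * Ψ^b is an identity of polynomials in `a`. Its linear
    -- coefficient is the derivative at `b` on one side and e_1 * Ψ^b on the other.
    have e : taylor (b : H) (eulerianSeries h x) = mul' k H[X]
        (TensorProduct.map (eulerianSeries h) (c ∘ₗ adams k H b) (Coalgebra.comul x)) :=
      natEval_injective (k := k) fun a _ => by
        rw [natEval_taylor, natEval_eulerianSeries, natEval_mul'_map k, hE, hc, adams_add]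
    rw [natEval_apply, ← taylor_coeff_one, e]
    induction (Coalgebra.comul x : H ⊗[k] H) with
    | zero => simp
    | tmul u v => simp [c, eulerian_apply]
    | add u v hu hv => simp only [map_add, coeff_add, hu, hv]
  -- Now `b` varies; the coefficient of b^j gives the recursion.
  have e : derivative (eulerianSeries h x) = mul' k H[X]
      (TensorProduct.map (c ∘ₗ eulerian h 1) (eulerianSeries h) (Coalgebra.comul x)) :=
    natEval_injective (k := k) fun b _ => by rw [h1, natEval_mul'_map k, hE, hc]
  have e' := congrArg (fun P => coeff P j) e
  simp only [coeff_derivative] at e'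
  have : ((j : k) + 1) • eulerian h (j + 1) x =
      (eulerianSeries h x).coeff (j + 1) * ((j : H) + 1) := by
    rw [eulerian_apply, Algebra.smul_def, map_add, map_natCast, map_one,
      ← Nat.cast_succ, (Nat.cast_commute (j + 1) _).eq]
  rw [this, e']
  induction (Coalgebra.comul x : H ⊗[k] H) with
  | zero => simp
  | tmul u v => simp [c, eulerian_apply]
  | add u v hu hv => simp only [map_add, coeff_add, hu, hv]

end AdamsOperation

namespace AdamsOperation

open Polynomial WithConv LinearMap

/-! ### Cocommutativity: e_1 takes primitive values -/

section Cocommutative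

variable (k : Type*) [Field k] {H : Type*} [Ring H] [Bialgebra k H]

theorem algHom_comp_adams {B : Type*} [Ring B] [Algebra k B] (f : H →ₐ[k] B) (m : ℕ) :
    toConv (f.toLinearMap ∘ₗ adams k H m) = toConv f.toLinearMap ^ m := by
  induction m with
  | zero => ext x; simp [adams_zero]
  | succ m ih =>
    rw [pow_succ, ← ih, ← toConv_ofConv (_ * _)]
    have := algHom_comp_convMul_distrib f (toConv (adams k H m)) (toConv (LinearMap.id : H →ₗ[k] H))
    change _ = (toConv (f.toLinearMap ∘ₗ adams k H m) * toConv f.toLinearMap).ofConv at this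
    rw [← this]
    congr 2

/-- On a cocommutative bialgebra the Adams operations are coalgebra morphisms. -/
theorem comul_adams [Coalgebra.IsCocomm k H] (m : ℕ) (x : H) :
    Coalgebra.comul (R := k) (adams k H m x) =
      TensorProduct.map (adams k H m) (adams k H m) (Coalgebra.comul x) := by
  let i₁ : H →ₐ[k] H ⊗[k] H := Algebra.TensorProduct.includeLeft
  let i₂ : H →ₐ[k] H ⊗[k] H := Algebra.TensorProduct.includeRight
  have h12 : ∀ (f g : H →ₗ[k] H), toConv (i₁.toLinearMap ∘ₗ f) * toConv (i₂.toLinearMap ∘ₗ g) =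
      toConv (TensorProduct.map f g ∘ₗ Coalgebra.comul) := by
    intro f g
    ext x
    rw [convMul_apply]
    change _ = TensorProduct.map f g (Coalgebra.comul x)
    induction (Coalgebra.comul x : H ⊗[k] H) with
    | zero => simp
    | tmul a b => simp [i₁, i₂]
    | add a b ha hb => simp only [map_add, ha, hb]
  have hΔ : toConv i₁.toLinearMap * toConv i₂.toLinearMap =
      toConv (Bialgebra.comulAlgHom k H).toLinearMap := by
    have := h12 LinearMap.id LinearMap.id
    rw [TensorProduct.map_id] at this
    exact this
  -- Cocommutativity enters here. It gives Δ^{*m} = (i₁ * i₂)^{*m} = i₁^{*m} * i₂^{*m}, and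
  -- composing Ψ^m with an algebra morphism gives the m-th convolution power of that morphism.
  have hcomm : Commute (toConv i₁.toLinearMap) (toConv i₂.toLinearMap) := by
    rw [Commute, SemiconjBy, hΔ]
    ext x
    change Coalgebra.comul x = LinearMap.mul' k _
      (TensorProduct.map i₂.toLinearMap i₁.toLinearMap (Coalgebra.comul x))
    conv_lhs => rw [← Coalgebra.comm_comul k x]
    induction (Coalgebra.comul x : H ⊗[k] H) with
    | zero => simp
    | tmul a b => simp [i₁, i₂]
    | add a b ha hb => simp only [map_add, ha, hb]
  have key := algHom_comp_adams k (Bialgebra.comulAlgHom k H) m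
  rw [← hΔ, hcomm.mul_pow, ← algHom_comp_adams, ← algHom_comp_adams, h12] at key
  exact DFunLike.congr_fun (toConv_injective key) x

variable {k} [CharZero k]

/-- The first Eulerian operator of a cocommutative bialgebra takes primitive values. -/
theorem comul_eulerian_one [Coalgebra.IsCocomm k H] (h : IsAdamsPolynomial k H) (x : H) :
    Coalgebra.comul (R := k) (eulerian h 1 x) = eulerian h 1 x ⊗ₜ[k] 1 + 1 ⊗ₜ[k] eulerian h 1 x := by
  let i₁ : H →ₐ[k] H ⊗[k] H := Algebra.TensorProduct.includeLeft
  let i₂ : H →ₐ[k] H ⊗[k] H := Algebra.TensorProduct.includeRight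
  have e : mapAlgHom (Bialgebra.comulAlgHom k H) (eulerianSeries h x) =
      mul' k (H ⊗[k] H)[X] (TensorProduct.map ((mapAlgHom i₁).toLinearMap ∘ₗ eulerianSeries h)
        ((mapAlgHom i₂).toLinearMap ∘ₗ eulerianSeries h) (Coalgebra.comul x)) :=
    natEval_injective (k := k) fun m _ => by
      rw [natEval_map, natEval_eulerianSeries]
      change Coalgebra.comul (R := k) (adams k H m x) = _
      rw [comul_adams]
      induction (Coalgebra.comul x : H ⊗[k] H) with
      | zero => simp
      | tmul a b =>
        rw [TensorProduct.map_tmul, TensorProduct.map_tmul, mul'_apply, map_mul]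
        change _ = natEval k m (mapAlgHom i₁ (eulerianSeries h a)) *
          natEval k m (mapAlgHom i₂ (eulerianSeries h b))
        rw [natEval_map, natEval_map, natEval_eulerianSeries, natEval_eulerianSeries]
        simp [i₁, i₂]
      | add a b ha hb => simp only [map_add, ha, hb]
  have e1 := congrArg (fun P => coeff P 1) e
  have hl : (mapAlgHom (Bialgebra.comulAlgHom k H) (eulerianSeries h x)).coeff 1 =
      Coalgebra.comul (R := k) (eulerian h 1 x) := by
    simp [eulerian_apply]
  change (mapAlgHom (Bialgebra.comulAlgHom k H) (eulerianSeries h x)).coeff 1 = _ at e1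
  rw [hl] at e1
  rw [e1]
  -- The linear coefficient of (Ψ^m ⊗ Ψ^m)Δ is (e_1 ⊗ e_0 + e_0 ⊗ e_1)Δ. Since e_0 = ηε, the counit
  -- axioms reduce it to the primitive form.
  have hT : ∀ T : H ⊗[k] H, (mul' k (H ⊗[k] H)[X]
      (TensorProduct.map ((mapAlgHom i₁).toLinearMap ∘ₗ eulerianSeries h)
        ((mapAlgHom i₂).toLinearMap ∘ₗ eulerianSeries h) T)).coeff 1 =
      eulerian h 1 (TensorProduct.rid k H (Coalgebra.counit.lTensor H T)) ⊗ₜ[k] 1 +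
      1 ⊗ₜ[k] eulerian h 1 (TensorProduct.lid k H (Coalgebra.counit.rTensor H T)) := by
    intro T
    induction T with
    | zero => simp
    | tmul a b =>
      have h0 : ∀ z, (eulerianSeries h z).coeff 0 = Coalgebra.counit (R := k) z • (1 : H) :=
        fun z => by rw [← eulerian_apply, eulerian_zero, Algebra.algebraMap_eq_smul_one]
      simp [mul_coeff_one, i₁, i₂, h0, ← eulerian_apply, TensorProduct.smul_tmul, add_comm]
    | add a b ha hb =>
      simp only [map_add, coeff_add, ha, hb, TensorProduct.add_tmul, TensorProduct.tmul_add]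
      abel
  rw [hT]
  simp

end Cocommutative

/-! ### Adams operations on powers of primitive elements -/

section Powers

variable (k : Type*) [Field k] {H : Type*} [Ring H] [Bialgebra k H]

theorem counit_of_primitive {x : H}
    (hx : Coalgebra.comul (R := k) x = x ⊗ₜ[k] 1 + 1 ⊗ₜ[k] x) :
    Coalgebra.counit (R := k) x = 0 := by
  have := Coalgebra.rTensor_counit_comul (R := k) x
  rw [hx] at this
  have := congrArg (fun t => Coalgebra.counit (R := k) (TensorProduct.lid k H t)) this
  simpa using this

/-- Since `x ⊗ 1` and `1 ⊗ x` commute, Δ(x^n) is a binomial sum; passing from `m` to `m + 1` is the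
binomial expansion of (m + 1)^n. -/
theorem adams_pow_of_primitive {x : H}
    (hx : Coalgebra.comul (R := k) x = x ⊗ₜ[k] 1 + 1 ⊗ₜ[k] x) (n m : ℕ) :
    adams k H m (x ^ n) = (m : k) ^ n • x ^ n := by
  have hε := counit_of_primitive k hx
  induction m generalizing n with
  | zero =>
    rw [adams_zero, Bialgebra.counit_pow, hε]
    rcases n with _ | n
    · simp
    · simp
  | succ m ih =>
    have hc : Commute (x ⊗ₜ[k] (1 : H)) ((1 : H) ⊗ₜ[k] x) := by
      simp [Commute, SemiconjBy]
    have hs : ∀ i ∈ Finset.range (n + 1),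
        mul' k H (TensorProduct.map (adams k H m) LinearMap.id
          ((x ⊗ₜ[k] (1 : H)) ^ i * ((1 : H) ⊗ₜ[k] x) ^ (n - i) * (n.choose i : H ⊗[k] H))) =
        ((m : k) ^ i * 1 ^ (n - i) * (n.choose i : k)) • x ^ n := by
      intro i hi
      have hin : i + (n - i) = n := by have := Finset.mem_range.mp hi; omega
      have : (x ⊗ₜ[k] (1 : H)) ^ i * ((1 : H) ⊗ₜ[k] x) ^ (n - i) * (n.choose i : H ⊗[k] H) =
          (n.choose i : k) • ((x ^ i : H) ⊗ₜ[k] (x ^ (n - i) : H)) := by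
        rw [Algebra.smul_def, map_natCast, (Nat.cast_commute _ _).eq]
        simp
      rw [this, map_smul, map_smul, TensorProduct.map_tmul, ih, mul'_apply, LinearMap.id_apply,
        smul_mul_assoc, ← pow_add, hin, smul_smul, one_pow, mul_one, mul_comm]
    rw [adams_succ, Bialgebra.comul_pow, hx, hc.add_pow, map_sum, map_sum, Finset.sum_congr rfl hs,
      ← Finset.sum_smul, ← (Commute.all (m : k) 1).add_pow, Nat.cast_succ]

theorem isAdamsPolynomial_of_span {s : Set H}
    (hs : ∀ x ∈ s, Coalgebra.comul (R := k) x = x ⊗ₜ[k] 1 + 1 ⊗ₜ[k] x)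
    (hspan : Submodule.span k {a | ∃ x ∈ s, ∃ n : ℕ, a = x ^ n} = ⊤) :
    IsAdamsPolynomial k H := by
  intro a
  have ha : a ∈ Submodule.span k {a | ∃ x ∈ s, ∃ n : ℕ, a = x ^ n} := hspan ▸ Submodule.mem_top
  induction ha using Submodule.span_induction with
  | mem a ha =>
    obtain ⟨x, hx, n, rfl⟩ := ha
    refine ⟨monomial n (x ^ n), fun m => ?_⟩
    rw [adams_pow_of_primitive k (hs x hx), natEval_monomial]
  | zero => exact ⟨0, fun m => by simp⟩
  | add a b _ _ ha hb =>
    obtain ⟨P, hP⟩ := ha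
    obtain ⟨Q, hQ⟩ := hb
    exact ⟨P + Q, fun m => by rw [map_add, hP, hQ, map_add]⟩
  | smul c a _ ha =>
    obtain ⟨P, hP⟩ := ha
    exact ⟨c • P, fun m => by rw [map_smul, hP, map_smul]⟩

/-- The polynomial of x^n is the single monomial m^n x^n, so e_1 fixes `x` and kills the other
powers. For an enveloping algebra this places e_1 in the image of the Lie algebra, without knowing
that this image is all the primitives. -/
theorem eulerian_one_mem_of_span [CharZero k] (h : IsAdamsPolynomial k H) (V : Submodule k H)
    (hV : ∀ x ∈ V, Coalgebra.comul (R := k) x = x ⊗ₜ[k] 1 + 1 ⊗ₜ[k] x)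
    (hspan : Submodule.span k {a | ∃ x ∈ V, ∃ n : ℕ, a = x ^ n} = ⊤) (a : H) :
    eulerian h 1 a ∈ V := by
  have ha : a ∈ Submodule.span k {a | ∃ x ∈ V, ∃ n : ℕ, a = x ^ n} := hspan ▸ Submodule.mem_top
  induction ha using Submodule.span_induction with
  | mem a ha =>
    obtain ⟨x, hx, n, rfl⟩ := ha
    have : eulerianSeries h (x ^ n) = monomial n (x ^ n) :=
      natEval_injective (k := k) fun m _ => by
        rw [natEval_eulerianSeries, adams_pow_of_primitive k (hV x hx), natEval_monomial]
    rw [eulerian_apply, this, coeff_monomial]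
    split_ifs with h1
    · rw [h1, pow_one]; exact hx
    · exact zero_mem _
  | zero => rw [map_zero]; exact zero_mem _
  | add a b _ _ ha hb => rw [map_add]; exact add_mem ha hb
  | smul c a _ ha => rw [map_smul]; exact V.smul_mem c ha

end Powers

end AdamsOperation

/-! ### Powers span the enveloping algebra -/

namespace UniversalEnvelopingAlgebra

open Polynomial

variable (k : Type*) [Field k] [CharZero k] {L : Type*} [LieRing L] [LieAlgebra k L]

/-- The sum is the coefficient of t in (x + t y)^(n+1). -/
theorem sum_pow_mul_pow_mem {A : Type*} [Ring A] [Algebra k A] (V : Submodule k A) (x y : A) (n : ℕ)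
    (h : ∀ m : ℕ, (x + (m : A) * y) ^ (n + 1) ∈ V) :
    ∑ i ∈ Finset.range (n + 1), x ^ i * y * x ^ (n - i) ∈ V := by
  have h0 : ∀ n, ((C x + C y * X) ^ n : A[X]).coeff 0 = x ^ n := by
    intro n
    induction n with
    | zero => simp
    | succ n ih => rw [pow_succ, mul_coeff_zero, ih]; simp [pow_succ]
  have h1 : ∀ n, ((C x + C y * X) ^ (n + 1) : A[X]).coeff 1 =
      ∑ i ∈ Finset.range (n + 1), x ^ i * y * x ^ (n - i) := by
    intro n
    induction n with
    | zero => simp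
    | succ n ih =>
      rw [pow_succ, mul_coeff_one, h0, ih, Finset.sum_range_succ _ (n + 1), Finset.sum_mul,
        add_comm]
      congr 1
      · refine Finset.sum_congr rfl fun i hi => ?_
        have : n + 1 - i = (n - i) + 1 := by have := Finset.mem_range.mp hi; omega
        rw [this, pow_succ]
        simp [mul_assoc]
      · simp
  rw [← h1]
  refine coeff_mem_of_natEval_mem V _ (fun m _ => ?_) 1
  rw [map_pow, map_add, map_mul, natEval_C, natEval_C, natEval_X, ← (Nat.cast_commute m y).eq]
  exact h m

/-- The powers of the elements of the Lie algebra span its enveloping algebra. -/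
theorem span_pow_eq_top :
    Submodule.span k {a : UniversalEnvelopingAlgebra k L |
      ∃ x ∈ LinearMap.range (ι k : L →ₗ⁅k⁆ UniversalEnvelopingAlgebra k L).toLinearMap,
        ∃ n : ℕ, a = x ^ n} = ⊤ := by
  set g := LinearMap.range (ι k : L →ₗ⁅k⁆ UniversalEnvelopingAlgebra k L).toLinearMap
  let V : ℕ → Submodule k (UniversalEnvelopingAlgebra k L) := fun n =>
    Submodule.span k {a | ∃ x ∈ g, ∃ j ≤ n, a = x ^ j}
  have hpow : ∀ {n j : ℕ} {x}, x ∈ g → j ≤ n → x ^ j ∈ V n := fun hx hj =>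
    Submodule.subset_span ⟨_, hx, _, hj, rfl⟩
  have hmono : Monotone V := fun m n hmn => Submodule.span_mono fun a ⟨x, hx, j, hj, e⟩ =>
    ⟨x, hx, j, hj.trans hmn, e⟩
  have hbr : ∀ {x y}, x ∈ g → y ∈ g → y * x - x * y ∈ g := by
    rintro _ _ ⟨x, rfl⟩ ⟨y, rfl⟩
    exact ⟨⁅y, x⁆, ι_bracket k y x⟩
  have hstep : ∀ n, ∀ y ∈ g, ∀ a ∈ V n, y * a ∈ V (n + 1) := by
    intro n
    induction n using Nat.strong_induction_on with
    | _ n ih =>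
    intro y hy a ha
    induction ha using Submodule.span_induction with
    | zero => rw [mul_zero]; exact zero_mem _
    | add a b _ _ ha hb => rw [mul_add]; exact add_mem ha hb
    | smul c a _ ha => rw [mul_smul_comm]; exact Submodule.smul_mem _ c ha
    | mem a ha =>
      obtain ⟨x, hx, j, hj, rfl⟩ := ha
      rcases hj.lt_or_eq with hlt | rfl
      · exact hmono (by omega) (ih j hlt y hy _ (hpow hx le_rfl))
      -- Moving `y` past powers of `x` only costs brackets, which lie in `g` and leave terms covered
      -- by the induction hypothesis.
      have hcomm : ∀ i m, i + m ≤ j → (y * x ^ i - x ^ i * y) * x ^ m ∈ V (i + m) := by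
        intro i
        induction i with
        | zero => intro m _; simp
        | succ i ihi =>
          intro m hm
          have e : (y * x ^ (i + 1) - x ^ (i + 1) * y) * x ^ m =
              (y * x - x * y) * x ^ (i + m) + x * ((y * x ^ i - x ^ i * y) * x ^ m) := by
            rw [pow_succ', pow_add]; noncomm_ring
          rw [e, Nat.add_right_comm]
          exact add_mem (ih _ (by omega) _ (hbr hx hy) _ (hpow hx le_rfl))
            (ih _ (by omega) x hx _ (ihi m (by omega)))
      have hsum : ∑ i ∈ Finset.range (j + 1), x ^ i * y * x ^ (j - i) ∈ V (j + 1) :=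
        sum_pow_mul_pow_mem k _ x y j fun m => hpow (add_mem hx (by
          rw [← nsmul_eq_mul]; exact nsmul_mem hy m)) le_rfl
      have hcs : ∑ i ∈ Finset.range (j + 1), (y * x ^ i - x ^ i * y) * x ^ (j - i) ∈ V (j + 1) :=
        sum_mem fun i hi => hmono (by have := Finset.mem_range.mp hi; omega)
          (hcomm i (j - i) (by have := Finset.mem_range.mp hi; omega))
      -- Each x^i y x^(j-i) is y x^j up to such a correction; characteristic zero allows division by
      -- `j + 1`.
      have e : ((j + 1 : ℕ) : k) • (y * x ^ j) =
          ∑ i ∈ Finset.range (j + 1), x ^ i * y * x ^ (j - i) +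
          ∑ i ∈ Finset.range (j + 1), (y * x ^ i - x ^ i * y) * x ^ (j - i) := by
        rw [← Finset.sum_add_distrib, Finset.sum_congr rfl (g := fun _ => y * x ^ j), Finset.sum_const,
          Finset.card_range, Nat.cast_smul_eq_nsmul]
        intro i hi
        have : i + (j - i) = j := by have := Finset.mem_range.mp hi; omega
        rw [← add_mul, add_sub_cancel, mul_assoc, ← pow_add, this]
      have := add_mem hsum hcs
      rw [← e] at this
      exact (Submodule.smul_mem_iff _ (Nat.cast_ne_zero.mpr j.succ_ne_zero)).mp this
  set W := Submodule.span k {a : UniversalEnvelopingAlgebra k L | ∃ x ∈ g, ∃ n : ℕ, a = x ^ n}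
  have hVW : ∀ n, V n ≤ W := fun n => Submodule.span_mono fun a ⟨x, hx, j, _, e⟩ => ⟨x, hx, j, e⟩
  have hmul : ∀ a, ∀ w ∈ W, a * w ∈ W := by
    intro a
    induction a using induction_ι k with
    | algebraMap c => intro w hw; rw [← Algebra.smul_def]; exact W.smul_mem c hw
    | mul a b ha hb => intro w hw; rw [mul_assoc]; exact ha _ (hb w hw)
    | add a b ha hb => intro w hw; rw [add_mul]; exact add_mem (ha w hw) (hb w hw)
    | ι x =>
      intro w hw
      induction hw using Submodule.span_induction with
      | zero => rw [mul_zero]; exact zero_mem _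
      | add a b _ _ ha hb => rw [mul_add]; exact add_mem ha hb
      | smul c a _ ha => rw [mul_smul_comm]; exact Submodule.smul_mem _ c ha
      | mem a ha =>
        obtain ⟨z, hz, j, rfl⟩ := ha
        exact hVW (j + 1) (hstep j _ ⟨x, rfl⟩ _ (hpow hz le_rfl))
  refine eq_top_iff.mpr fun a _ => ?_
  have h1 : (1 : UniversalEnvelopingAlgebra k L) ∈ W :=
    Submodule.subset_span ⟨0, zero_mem _, 0, (pow_zero _).symm⟩
  simpa using hmul a 1 h1

end UniversalEnvelopingAlgebra

/-! ### Connected families of subspaces -/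

namespace HopfAlgebra

open Polynomial WithConv LinearMap AdamsOperation

variable (k : Type*) [Field k] {H : Type*} [Ring H] [HopfAlgebra k H]

/-- The common tool for degree estimates: a convolution product on the `n`-th piece need only be
checked on pure tensors of total degree `n`. -/
theorem mul'_map_mem {A : Type*} [Ring A] [Algebra k A] (G : ℕ → Submodule k H) (n : ℕ)
    (f g : H →ₗ[k] A) (W : Submodule k A)
    (h : ∀ p q, p + q = n → ∀ a ∈ G p, ∀ b ∈ G q, f a * g b ∈ W) {T : H ⊗[k] H}
    (hT : T ∈ ⨆ pq ∈ Finset.HasAntidiagonal.antidiagonal n,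
      tensorSubmodule k (G pq.1) (G pq.2)) :
    mul' k A (TensorProduct.map f g T) ∈ W := by
  suffices hle : (⨆ pq ∈ Finset.HasAntidiagonal.antidiagonal n,
      tensorSubmodule k (G pq.1) (G pq.2)) ≤ W.comap (mul' k A ∘ₗ TensorProduct.map f g) from hle hT
  refine iSup₂_le fun pq hpq => ?_
  rintro _ ⟨t, rfl⟩
  change mul' k A (TensorProduct.map f g _) ∈ W
  induction t with
  | zero => simp
  | tmul a b => exact h _ _ (Finset.HasAntidiagonal.mem_antidiagonal.mp hpq) _ a.2 _ b.2
  | add a b ha hb => simp only [map_add]; exact add_mem ha hb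

/-- A family of subspaces of a Hopf algebra that is exhaustive and compatible with product and
coproduct, and whose degree-zero piece consists of scalars. Connected filtrations and connected
gradings are examples. -/
structure IsConnectedFamily (G : ℕ → Submodule k H) : Prop where
  iSup_eq_top : ⨆ n, G n = ⊤
  mul_mem : ∀ p q : ℕ, ∀ x ∈ G p, ∀ y ∈ G q, x * y ∈ G (p + q)
  comul_mem : ∀ n : ℕ, ∀ x ∈ G n, Coalgebra.comul (R := k) x ∈
    ⨆ pq ∈ Finset.HasAntidiagonal.antidiagonal n, tensorSubmodule k (G pq.1) (G pq.2)
  algebraMap_counit : ∀ x ∈ G 0, algebraMap k H (Coalgebra.counit (R := k) x) = x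

namespace IsConnectedFamily

variable {k} {G : ℕ → Submodule k H} (hG : IsConnectedFamily k G)

include hG

/-- J = id - ηε kills the degree-zero piece, so each further factor J uses up at least one degree.
-/
theorem id_sub_one_pow_eq_zero (j : ℕ) : ∀ n, n < j → ∀ x ∈ G n,
    ((toConv (LinearMap.id : H →ₗ[k] H) - 1) ^ j) x = 0 := by
  induction j with
  | zero => intro n hn; omega
  | succ j ih =>
    intro n hn x hx
    rw [pow_succ, convMul_apply, ← Submodule.mem_bot k]
    refine mul'_map_mem k G n _ _ ⊥ (fun p q hpq a ha b hb => ?_) (hG.comul_mem n x hx)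
    rw [Submodule.mem_bot]
    rcases q.eq_zero_or_pos with rfl | hq
    · have : (toConv (LinearMap.id : H →ₗ[k] H) - 1).ofConv b = 0 := by
        change b - algebraMap k H (Coalgebra.counit (R := k) b) = 0
        rw [hG.algebraMap_counit b hb, sub_self]
      rw [this, mul_zero]
    · rw [ih p (by omega) a ha, zero_mul]

theorem isAdamsPolynomial [CharZero k] : IsAdamsPolynomial k H := by
  intro x
  have hx : x ∈ ⨆ n, G n := hG.iSup_eq_top ▸ Submodule.mem_top
  induction hx using Submodule.iSup_induction' with
  | zero => exact ⟨0, fun m => by simp⟩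
  | add a b _ _ ha hb =>
    obtain ⟨P, hP⟩ := ha
    obtain ⟨Q, hQ⟩ := hb
    exact ⟨P + Q, fun m => by rw [map_add, hP, hQ, map_add]⟩
  | mem n x hx =>
    set J : WithConv (H →ₗ[k] H) := toConv LinearMap.id - 1 with hJ
    let q : ℕ → k[X] := fun i => C ((i.factorial : k)⁻¹) * descPochhammer k i
    have hq : ∀ i m : ℕ, natEval k m (q i) = (m.choose i : k) := fun i m => by
      rw [Nat.cast_choose_eq_descPochhammer_div, natEval_apply, eval_mul, eval_C, div_eq_inv_mul]
    refine ⟨∑ i ∈ Finset.range (n + 1), mapAlgHom (Algebra.ofId k H) (q i) * C ((J ^ i) x),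
      fun m => ?_⟩
    have hadams : adams k H m x = ∑ i ∈ Finset.range (m + 1), (m.choose i : k) • (J ^ i) x := by
      have : toConv (LinearMap.id : H →ₗ[k] H) = J + 1 := by rw [hJ, sub_add_cancel]
      rw [adams, this, (Commute.one_right J).add_pow, ofConv_sum, LinearMap.sum_apply]
      refine Finset.sum_congr rfl fun i _ => ?_
      rw [one_pow, mul_one, ← (Nat.cast_commute _ _).eq, ← nsmul_eq_mul, Nat.cast_smul_eq_nsmul]
      rfl
    have hterm : ∀ i, natEval k m (mapAlgHom (Algebra.ofId k H) (q i) * C ((J ^ i) x)) =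
        (m.choose i : k) • (J ^ i) x := fun i => by
      rw [map_mul, natEval_map, hq, natEval_C, Algebra.ofId_apply, ← Algebra.smul_def]
    rw [hadams, map_sum, Finset.sum_congr rfl fun i _ => hterm i]
    -- Both sums are compared over a common range: (m choose i) = 0 for i > m, and J^i x = 0 for i >
    -- n.
    rw [Finset.sum_subset (s₂ := Finset.range (m + n + 1))
        (Finset.range_subset_range.mpr (by omega)),
      ← Finset.sum_subset (s₁ := Finset.range (m + 1)) (s₂ := Finset.range (m + n + 1))
        (Finset.range_subset_range.mpr (by omega))]
    · intro i _ hi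
      rw [Nat.choose_eq_zero_of_lt (by simpa using hi), Nat.cast_zero, zero_smul]
    · intro i _ hi
      rw [hG.id_sub_one_pow_eq_zero i n (by simp at hi; omega) x hx, smul_zero]

theorem adams_mem {n m : ℕ} (hm : 1 ≤ m) : ∀ {x : H}, x ∈ G n → adams k H m x ∈ G n := by
  induction m, hm using Nat.le_induction generalizing n with
  | base => intro x hx; rwa [adams_one]
  | succ m _ ih =>
    intro x hx
    rw [adams_succ]
    refine mul'_map_mem k G n _ _ _ (fun p q hpq a ha b hb => ?_) (hG.comul_mem n x hx)
    rw [← hpq]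
    exact hG.mul_mem _ _ _ (ih ha) _ hb

end IsConnectedFamily

/-! ### The canonical morphism and the isomorphism theorem -/

variable (H) in
/-- The algebra morphism from the enveloping algebra of the primitive elements that extends the
inclusion. -/
noncomputable def primitivesLiftAlgHom :
    UniversalEnvelopingAlgebra k (primitives k H) →ₐ[k] H :=
  UniversalEnvelopingAlgebra.liftOfBracket k ((primitives k H).incl : primitives k H →ₗ[k] H)
    fun x y => LieRing.of_associative_ring_bracket (x : H) y

theorem primitivesLiftAlgHom_ι (x : primitives k H) :
    primitivesLiftAlgHom k H (UniversalEnvelopingAlgebra.ι k x) = x :=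
  UniversalEnvelopingAlgebra.liftOfBracket_ι k _ _ x

variable (H) in
/-- The morphism of `primitivesLiftAlgHom`, as a morphism of bialgebras. -/
noncomputable def primitivesLift : UniversalEnvelopingAlgebra k (primitives k H) →ₐc[k] H :=
  .ofAlgHom (primitivesLiftAlgHom k H)
    (UniversalEnvelopingAlgebra.algHom_ext_ι k fun x => by
      rw [AlgHom.comp_apply, primitivesLiftAlgHom_ι]
      exact (counit_of_primitive k x.2).trans (UniversalEnvelopingAlgebra.counit_ι k x).symm)
    (UniversalEnvelopingAlgebra.algHom_ext_ι k fun x => by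
      rw [AlgHom.comp_apply, AlgHom.comp_apply, primitivesLiftAlgHom_ι,
        Bialgebra.comulAlgHom_apply, UniversalEnvelopingAlgebra.comul_ι, map_add,
        Algebra.TensorProduct.map_tmul, Algebra.TensorProduct.map_tmul, primitivesLiftAlgHom_ι,
        map_one]
      exact x.2.symm)

theorem primitivesLift_ι (x : primitives k H) :
    primitivesLift k H (UniversalEnvelopingAlgebra.ι k x) = x :=
  primitivesLiftAlgHom_ι k x

/-- f ∘ S and S ∘ f are a left and a right convolution inverse of f, hence equal. -/
theorem map_antipode {A B : Type*} [Ring A] [HopfAlgebra k A] [Ring B] [HopfAlgebra k B]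
    (f : A →ₐc[k] B) (a : A) : f (antipode k a) = antipode k (f a) := by
  let F : A →ₗ[k] B := (f : A →ₐ[k] B).toLinearMap
  have h1 : toConv (F ∘ₗ antipode k) * toConv F = 1 := by
    have := algHom_comp_convMul_distrib (f : A →ₐ[k] B) (toConv (antipode k (A := A)))
      (toConv LinearMap.id)
    rw [antipode_mul_id, algHom_comp_convOne] at this
    exact (ofConv_injective this).symm
  have h2 : toConv F * toConv (antipode k ∘ₗ F) = 1 := by
    have := convMul_comp_coalgHom_distrib (toConv LinearMap.id) (toConv (antipode k (A := B)))
      (f : A →ₗc[k] B)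
    rw [id_mul_antipode, convOne_comp_coalgHom] at this
    exact (ofConv_injective this).symm
  exact DFunLike.congr_fun (toConv_injective (left_inv_eq_right_inv h1 h2)) a

variable {k}

section Isomorphism

open UniversalEnvelopingAlgebra

variable [CharZero k] [Coalgebra.IsCocomm k H] {G : ℕ → Submodule k H}
  (hG : IsConnectedFamily k G) (I : ℕ → Submodule k (UniversalEnvelopingAlgebra k (primitives k H)))
  (hI_mul : ∀ p q : ℕ, ∀ x ∈ I p, ∀ y ∈ I q, x * y ∈ I (p + q))
  (hI_ι : ∀ n, ∀ x : primitives k H, (x : H) ∈ G n → ι k x ∈ I n)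
  (hI_counit : ∀ n, ∀ x ∈ G n, algebraMap k _ (Coalgebra.counit (R := k) x) ∈ I n)

include hG hI_mul hI_ι hI_counit in
/-- The Eulerian operators of the enveloping algebra factor through `primitivesLift`. -/
theorem exists_eulerian_factor (hU : IsAdamsPolynomial k H)
    (hE : IsAdamsPolynomial k (UniversalEnvelopingAlgebra k (primitives k H))) (j : ℕ) :
    ∃ χ : H →ₗ[k] UniversalEnvelopingAlgebra k (primitives k H),
      (∀ a, eulerian hE j a = χ (primitivesLift k H a)) ∧
      (∀ x, primitivesLift k H (χ x) = eulerian hU j x) ∧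
      ∀ n, ∀ x ∈ G n, χ x ∈ I n := by
  let θ : H →ₗ[k] primitives k H :=
    (eulerian hU 1).codRestrict (primitives k H).toSubmodule fun x => comul_eulerian_one hU x
  let χ₁ : H →ₗ[k] UniversalEnvelopingAlgebra k (primitives k H) :=
    (ι k : primitives k H →ₗ⁅k⁆ _).toLinearMap ∘ₗ θ
  have hχ₁ : ∀ x, primitivesLift k H (χ₁ x) = eulerian hU 1 x := fun x => primitivesLift_ι k _
  have hχ₁E : ∀ a, eulerian hE 1 a = χ₁ (primitivesLift k H a) := by
    intro a
    obtain ⟨z, hz⟩ := eulerian_one_mem_of_span k hE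
      (LinearMap.range (ι k : primitives k H →ₗ⁅k⁆ _).toLinearMap)
      (by rintro _ ⟨x, rfl⟩; exact comul_ι k x) (span_pow_eq_top k) a
    change ι k z = _ at hz
    -- Applying φ to ι z = e_1(a) gives z = e_1(φ a) in `H`; injectivity of ι is not needed.
    have : z = θ (primitivesLift k H a) := Subtype.ext (by
      rw [← primitivesLift_ι k z, hz, map_eulerian hE hU]; rfl)
    rw [← hz, this]; rfl
  have hχ₁I : ∀ n, ∀ x ∈ G n, χ₁ x ∈ I n := fun n x hx =>
    hI_ι n _ (eulerian_mem hU (G n) (fun m hm => hG.adams_mem hm hx) 1)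
  induction j with
  | zero =>
    refine ⟨Algebra.linearMap k _ ∘ₗ Coalgebra.counit, fun a => ?_, fun x => ?_, hI_counit⟩
    · rw [eulerian_zero, LinearMap.comp_apply, CoalgHomClass.counit_comp_apply]; rfl
    · rw [eulerian_zero, LinearMap.comp_apply, Algebra.linearMap_apply, AlgHomClass.commutes]
  | succ j ih =>
    obtain ⟨χ, h1, h2, h3⟩ := ih
    have hj : ((j : k) + 1) ≠ 0 := by exact_mod_cast j.succ_ne_zero
    -- χ_{j+1} = (χ_1 * χ_j)/(j+1) copies the recursion for the e_j.
    refine ⟨((j : k) + 1)⁻¹ • (mul' k _ ∘ₗ TensorProduct.map χ₁ χ ∘ₗ Coalgebra.comul),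
      fun a => ?_, fun x => ?_, fun n x hx => ?_⟩
    · rw [LinearMap.smul_apply, eq_inv_smul_iff₀ hj, eulerian_succ, LinearMap.comp_apply,
        LinearMap.comp_apply, ← CoalgHomClass.map_comp_comul_apply]
      congr 1
      induction (Coalgebra.comul a : UniversalEnvelopingAlgebra k (primitives k H) ⊗[k] _) with
      | zero => simp
      | tmul u v => simp [hχ₁E, h1]
      | add u v hu hv => simp only [map_add, hu, hv]
    · rw [LinearMap.smul_apply, map_smul, inv_smul_eq_iff₀ hj, eulerian_succ, LinearMap.comp_apply,
        LinearMap.comp_apply]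
      induction (Coalgebra.comul x : H ⊗[k] H) with
      | zero => simp
      | tmul u v => simp [hχ₁, h2]
      | add u v hu hv => simp only [map_add, hu, hv]
    · refine Submodule.smul_mem _ _ (mul'_map_mem k G n _ _ _ (fun p q hpq a ha b hb => ?_)
        (hG.comul_mem n x hx))
      rw [← hpq]
      exact hI_mul _ _ _ (hχ₁I p a ha) _ (h3 q b hb)

include hG hI_mul hI_ι hI_counit in
/-- The isomorphism of a cocommutative Hopf algebra with a connected family of subspaces with the
enveloping algebra of its primitive elements. -/
theorem exists_equiv_of_isConnectedFamily (hI_le : ∀ n, ∀ a ∈ I n, primitivesLift k H a ∈ G n) :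
    ∃ e : UniversalEnvelopingAlgebra k (primitives k H) ≃ₐc[k] H,
      (∀ x : primitives k H, e (ι k x) = x) ∧
      (∀ a, e (antipode k a) = antipode k (e a)) ∧ ∀ n a, e a ∈ G n ↔ a ∈ I n := by
  have hU := hG.isAdamsPolynomial
  have hE : IsAdamsPolynomial k (UniversalEnvelopingAlgebra k (primitives k H)) := by
    refine isAdamsPolynomial_of_span k ?_ (span_pow_eq_top k)
    rintro _ ⟨x, rfl⟩
    exact comul_ι k x
  choose χ h1 h2 h3 using exists_eulerian_factor hG I hI_mul hI_ι hI_counit hU hE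
  have hinj : Function.Injective (primitivesLift k H) := by
    rw [injective_iff_map_eq_zero]
    intro a ha
    rw [← sum_eulerian hE a]
    exact Finset.sum_eq_zero fun j _ => by rw [h1, ha, map_zero]
  have hpre : ∀ n, ∀ x ∈ G n, ∃ a ∈ I n, primitivesLift k H a = x := fun n x hx =>
    ⟨∑ j ∈ (eulerianSeries hU x).support, χ j x, sum_mem fun j _ => h3 j n x hx, by
      rw [map_sum, Finset.sum_congr rfl fun j _ => h2 j x, sum_eulerian]⟩
  have hsurj : Function.Surjective (primitivesLift k H) := by
    intro x
    have hx : x ∈ ⨆ n, G n := hG.iSup_eq_top ▸ Submodule.mem_top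
    induction hx using Submodule.iSup_induction' with
    | mem n x hx => exact (hpre n x hx).imp fun a ha => ha.2
    | zero => exact ⟨0, map_zero _⟩
    | add x y _ _ hx hy =>
      obtain ⟨a, rfl⟩ := hx
      obtain ⟨b, rfl⟩ := hy
      exact ⟨a + b, map_add _ _ _⟩
  refine ⟨.ofBijective (primitivesLift k H) ⟨hinj, hsurj⟩, primitivesLift_ι k,
    map_antipode k (primitivesLift k H), fun n a => ⟨fun ha => ?_, hI_le n a⟩⟩
  obtain ⟨b, hb, hba⟩ := hpre n _ ha
  rwa [← hinj hba]

end Isomorphism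

end HopfAlgebra

/-! ### Transport of structure, and connectedness from a one-dimensional degree-zero piece -/

namespace HopfAlgebra

open AdamsOperation

variable (k : Type*) [Field k]

section Transport

variable {A B : Type*} [Ring A] [HopfAlgebra k A] [Ring B] [HopfAlgebra k B]

theorem comul_mem_of_equiv (e : A ≃ₐc[k] B) {I : ℕ → Submodule k A} {G : ℕ → Submodule k B}
    (hIG : ∀ n a, e a ∈ G n ↔ a ∈ I n) {n : ℕ} {a : A}
    (h : Coalgebra.comul (R := k) (e a) ∈
      ⨆ pq ∈ Finset.HasAntidiagonal.antidiagonal n, tensorSubmodule k (G pq.1) (G pq.2)) :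
    Coalgebra.comul (R := k) a ∈
      ⨆ pq ∈ Finset.HasAntidiagonal.antidiagonal n, tensorSubmodule k (I pq.1) (I pq.2) := by
  let f : B →ₗ[k] A := (e.symm : B →ₐc[k] A)
  have hf : ∀ b, f b = e.symm b := fun _ => rfl
  have hfa : TensorProduct.map f f (Coalgebra.comul (e a)) = Coalgebra.comul (R := k) a := by
    have := CoalgHomClass.map_comp_comul_apply (R := k) (e.symm : B →ₐc[k] A) (e a)
    refine this.trans ?_
    congr 1
    exact e.symm_apply_apply a
  rw [← hfa]
  suffices hle : (⨆ pq ∈ Finset.HasAntidiagonal.antidiagonal n,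
      tensorSubmodule k (G pq.1) (G pq.2)) ≤
      Submodule.comap (TensorProduct.map f f) (⨆ pq ∈ Finset.HasAntidiagonal.antidiagonal n,
        tensorSubmodule k (I pq.1) (I pq.2)) from hle h
  refine iSup₂_le fun pq hpq => le_trans ?_
    (Submodule.comap_mono (le_iSup₂ (f := fun (pq : ℕ × ℕ) _ =>
      tensorSubmodule k (I pq.1) (I pq.2)) pq hpq))
  rintro _ ⟨t, rfl⟩
  change TensorProduct.map f f _ ∈ tensorSubmodule k (I pq.1) (I pq.2)
  induction t with
  | zero => simp
  | tmul x y =>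
    have hm : ∀ m, ∀ x ∈ G m, f x ∈ I m := fun m x hx =>
      (hIG m _).mp (by rw [hf, BialgEquiv.apply_symm_apply]; exact hx)
    exact ⟨⟨f x, hm _ _ x.2⟩ ⊗ₜ ⟨f y, hm _ _ y.2⟩, rfl⟩
  | add x y hx hy => simp only [map_add]; exact add_mem hx hy

theorem IsFiltered.of_equiv (e : A ≃ₐc[k] B) (he : ∀ a, e (antipode k a) = antipode k (e a))
    {I : ℕ → Submodule k A} {G : ℕ → Submodule k B} (hIG : ∀ n a, e a ∈ G n ↔ a ∈ I n)
    (hG : IsFiltered k G) : IsFiltered k I where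
  mono m n hmn a ha := (hIG n a).mp (hG.mono hmn ((hIG m a).mpr ha))
  exhaustive a := (hG.exhaustive (e a)).imp fun n hn => (hIG n a).mp hn
  mul_mem p q x hx y hy := (hIG _ _).mp (by
    rw [map_mul]; exact hG.mul_mem p q _ ((hIG _ _).mpr hx) _ ((hIG _ _).mpr hy))
  comul_mem n a ha := comul_mem_of_equiv k e hIG (hG.comul_mem n _ ((hIG n a).mpr ha))
  antipode_mem n a ha := (hIG _ _).mp (by
    rw [he]; exact hG.antipode_mem n _ ((hIG _ _).mpr ha))

theorem IsGraded.of_equiv (e : A ≃ₐc[k] B) {I : ℕ → Submodule k A} {G : ℕ → Submodule k B}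
    (hIG : ∀ n a, e a ∈ G n ↔ a ∈ I n) (hG : IsGraded k G) : IsGraded k I where
  isInternal := by
    let f : A ≃ₗ[k] B := ((e : A ≃ₐ[k] B) : A ≃ₗ[k] B)
    -- Internal directness is a lattice condition (independence and supremum), so it passes through
    -- the isomorphism of submodule lattices.
    have hI : I = (Submodule.orderIsoMapComap f).symm ∘ G := by
      ext n a
      exact (hIG n a).symm
    have h := (DirectSum.isInternal_submodule_iff_iSupIndep_and_iSup_eq_top G).mp hG.isInternal
    rw [DirectSum.isInternal_submodule_iff_iSupIndep_and_iSup_eq_top, hI]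
    refine ⟨h.1.map_orderIso _, ?_⟩
    rw [← OrderIso.map_top (Submodule.orderIsoMapComap f).symm, ← h.2, OrderIso.map_iSup]
    rfl
  mul_mem p q x hx y hy := (hIG _ _).mp (by
    rw [map_mul]; exact hG.mul_mem p q _ ((hIG _ _).mpr hx) _ ((hIG _ _).mpr hy))
  comul_mem n a ha := comul_mem_of_equiv k e hIG (hG.comul_mem n _ ((hIG n a).mpr ha))

end Transport

section Connected

variable {H : Type*} [Ring H] [HopfAlgebra k H]

/-- A one-dimensional subspace that is closed under product and coproduct consists of scalars. -/
theorem one_mem_and_algebraMap_counit_of_finrank {V : Submodule k H} (hV : Module.finrank k V = 1)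
    (hmul : ∀ x ∈ V, ∀ y ∈ V, x * y ∈ V)
    (hcomul : ∀ x ∈ V, Coalgebra.comul (R := k) x ∈ tensorSubmodule k V V) :
    1 ∈ V ∧ ∀ x ∈ V, algebraMap k H (Coalgebra.counit (R := k) x) = x := by
  obtain ⟨⟨x, hx⟩, hx0, hspan⟩ := finrank_eq_one_iff'.mp hV
  have hspan : ∀ y ∈ V, ∃ c : k, c • x = y := fun y hy =>
    (hspan ⟨y, hy⟩).imp fun c hc => congrArg Subtype.val hc
  have hx0 : x ≠ 0 := fun h => hx0 (Subtype.ext h)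
  have hΔ : ∃ c : k, Coalgebra.comul (R := k) x = c • (x ⊗ₜ[k] x) := by
    obtain ⟨t, ht⟩ := hcomul x hx
    rw [← ht]
    clear ht
    induction t with
    | zero => exact ⟨0, by simp⟩
    | tmul a b =>
      obtain ⟨c, hc⟩ := hspan a a.2
      obtain ⟨d, hd⟩ := hspan b b.2
      refine ⟨c * d, ?_⟩
      change (a : H) ⊗ₜ[k] (b : H) = _
      rw [← hc, ← hd, TensorProduct.smul_tmul_smul]
    | add s t hs ht =>
      obtain ⟨c, hc⟩ := hs
      obtain ⟨d, hd⟩ := ht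
      exact ⟨c + d, by rw [map_add, hc, hd, add_smul]⟩
  obtain ⟨c, hc⟩ := hΔ
  have hcε : c * Coalgebra.counit (R := k) x = 1 := by
    have := congrArg (TensorProduct.lid k H) (Coalgebra.rTensor_counit_comul (R := k) x)
    rw [hc, map_smul, map_smul, LinearMap.rTensor_tmul, TensorProduct.lid_tmul,
      TensorProduct.lid_tmul, one_smul, smul_smul] at this
    exact smul_left_injective k hx0 (this.trans (one_smul k x).symm)
  -- Δx = c x ⊗ x and c ε(x) = 1 make `c • x` the group-like multiple of `x`.
  have hgl : IsGroupLikeElem k (c • x) :=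
    ⟨by rw [map_smul, smul_eq_mul, hcε],
      by rw [map_smul, hc, TensorProduct.smul_tmul_smul, smul_smul]⟩
  have hc0 : c ≠ 0 := left_ne_zero_of_mul_eq_one hcε
  -- The square of `c • x` is again a multiple of `x`, and the counit identifies it with `c • x`. A
  -- group-like element is invertible, so this idempotent is 1.
  have hy : c • x = 1 := by
    obtain ⟨d, hd⟩ := hspan _ (hmul _ (V.smul_mem c hx) _ (V.smul_mem c hx))
    have hd1 : d * Coalgebra.counit (R := k) x = 1 := by
      have := congrArg (Coalgebra.counit (R := k)) hd
      rwa [Bialgebra.counit_mul, hgl.counit_eq_one, map_smul, smul_eq_mul, mul_one] at this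
    have hdc : d = c := mul_right_cancel₀ (right_ne_zero_of_mul_eq_one hcε) (hd1.trans hcε.symm)
    rw [hdc] at hd
    exact hgl.isUnit.mul_left_cancel (hd.symm.trans (mul_one _).symm)
  have h1 : (1 : H) ∈ V := hy ▸ V.smul_mem c hx
  refine ⟨h1, fun z hz => ?_⟩
  obtain ⟨d, rfl⟩ := hspan z hz
  have hx1 : x = c⁻¹ • (1 : H) := by rw [← hy, smul_smul, inv_mul_cancel₀ hc0, one_smul]
  rw [hx1, smul_smul, ← Algebra.algebraMap_eq_smul_one, Bialgebra.counit_algebraMap]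

theorem one_mem_and_algebraMap_counit_of_finrank_zero {G : ℕ → Submodule k H}
    (hG : Module.finrank k (G 0) = 1)
    (hmul : ∀ p q : ℕ, ∀ x ∈ G p, ∀ y ∈ G q, x * y ∈ G (p + q))
    (hcomul : ∀ n : ℕ, ∀ x ∈ G n, Coalgebra.comul (R := k) x ∈
      ⨆ pq ∈ Finset.HasAntidiagonal.antidiagonal n, tensorSubmodule k (G pq.1) (G pq.2)) :
    1 ∈ G 0 ∧ ∀ x ∈ G 0, algebraMap k H (Coalgebra.counit (R := k) x) = x :=
  one_mem_and_algebraMap_counit_of_finrank k hG (hmul 0 0) fun x hx => by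
    simpa using hcomul 0 x hx

theorem IsFiltered.isConnectedFamily {F : ℕ → Submodule k H} (hF : IsFiltered k F)
    (h0 : Module.finrank k (F 0) = 1) : IsConnectedFamily k F where
  iSup_eq_top := eq_top_iff.mpr fun x _ =>
    (hF.exhaustive x).elim fun n hn => Submodule.mem_iSup_of_mem n hn
  mul_mem := hF.mul_mem
  comul_mem := hF.comul_mem
  algebraMap_counit :=
    (one_mem_and_algebraMap_counit_of_finrank_zero k h0 hF.mul_mem hF.comul_mem).2

theorem IsGraded.isConnectedFamily {𝒜 : ℕ → Submodule k H} (h𝒜 : IsGraded k 𝒜)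
    (h0 : Module.finrank k (𝒜 0) = 1) : IsConnectedFamily k 𝒜 where
  iSup_eq_top := h𝒜.isInternal.submodule_iSup_eq_top
  mul_mem := h𝒜.mul_mem
  comul_mem := h𝒜.comul_mem
  algebraMap_counit :=
    (one_mem_and_algebraMap_counit_of_finrank_zero k h0 h𝒜.mul_mem h𝒜.comul_mem).2

/-- The operator e_0 = ηε preserves each piece, being a coefficient of the Ψ^m with m ≥ 1. So ε(x)1
lies in both 𝒜 n and 𝒜 0, which meet only in 0. -/
theorem IsGraded.counit_eq_zero [CharZero k] {𝒜 : ℕ → Submodule k H} (h𝒜 : IsGraded k 𝒜)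
    (h0 : Module.finrank k (𝒜 0) = 1) {n : ℕ} (hn : n ≠ 0) {x : H} (hx : x ∈ 𝒜 n) :
    Coalgebra.counit (R := k) x = 0 := by
  have hc := h𝒜.isConnectedFamily k h0
  have h1 := (one_mem_and_algebraMap_counit_of_finrank_zero k h0 h𝒜.mul_mem h𝒜.comul_mem).1
  have hxn := eulerian_mem hc.isAdamsPolynomial (𝒜 n) (fun m hm => hc.adams_mem hm hx) 0
  rw [eulerian_zero] at hxn
  have hx0 : algebraMap k H (Coalgebra.counit (R := k) x) ∈ 𝒜 0 := by
    rw [Algebra.algebraMap_eq_smul_one]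
    exact (𝒜 0).smul_mem _ h1
  have := Submodule.disjoint_def.mp
    (h𝒜.isInternal.submodule_iSupIndep.pairwiseDisjoint hn) _ hxn hx0
  rw [← Bialgebra.counit_algebraMap (A := H) (Coalgebra.counit (R := k) x), this, map_zero]

theorem primitivesLift_prod_mem {G : ℕ → Submodule k H} (h1 : 1 ∈ G 0)
    (hmul : ∀ p q : ℕ, ∀ x ∈ G p, ∀ y ∈ G q, x * y ∈ G (p + q)) (l : List (ℕ × primitives k H))
    (hl : ∀ p ∈ l, p.2 ∈ primitivePart k G p.1) :
    primitivesLift k H (l.map fun p => UniversalEnvelopingAlgebra.ι k p.2).prod ∈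
      G (l.map Prod.fst).sum := by
  induction l with
  | nil => simpa using h1
  | cons p l ih =>
    simp only [List.map_cons, List.prod_cons, map_mul, primitivesLift_ι, List.sum_cons]
    exact hmul _ _ _ (hl p List.mem_cons_self) _ (ih fun q hq => hl q (List.mem_cons_of_mem p hq))

end Connected

end HopfAlgebra

/-! ### Elementary properties of the induced filtration and grading -/

namespace UniversalEnvelopingAlgebra

variable (k : Type*) [Field k] {L : Type*} [LieRing L] [LieAlgebra k L] (G : ℕ → Submodule k L)

theorem inducedFiltration_mul_mem (p q : ℕ) : ∀ x ∈ inducedFiltration k G p,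
    ∀ y ∈ inducedFiltration k G q, x * y ∈ inducedFiltration k G (p + q) := by
  intro x hx y hy
  have h := Submodule.mul_mem_mul hx hy
  rw [inducedFiltration, inducedFiltration, Submodule.span_mul_span] at h
  refine Submodule.span_mono ?_ h
  rintro _ ⟨_, ⟨l, hl, hs, rfl⟩, _, ⟨l', hl', hs', rfl⟩, rfl⟩
  exact ⟨l ++ l', fun r hr => (List.mem_append.mp hr).elim (hl r) (hl' r), by simp; omega, by simp⟩

theorem inducedGrading_mul_mem (p q : ℕ) : ∀ x ∈ inducedGrading k G p,
    ∀ y ∈ inducedGrading k G q, x * y ∈ inducedGrading k G (p + q) := by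
  intro x hx y hy
  have h := Submodule.mul_mem_mul hx hy
  rw [inducedGrading, inducedGrading, Submodule.span_mul_span] at h
  refine Submodule.span_mono ?_ h
  rintro _ ⟨_, ⟨l, hl, hs, rfl⟩, _, ⟨l', hl', hs', rfl⟩, rfl⟩
  exact ⟨l ++ l', fun r hr => (List.mem_append.mp hr).elim (hl r) (hl' r), by simp; omega, by simp⟩

theorem ι_mem_inducedFiltration {n : ℕ} {x : L} (hx : x ∈ G n) :
    ι k x ∈ inducedFiltration k G n :=
  Submodule.subset_span ⟨[(n, x)], by simpa using hx, by simp, by simp⟩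

theorem ι_mem_inducedGrading {n : ℕ} {x : L} (hx : x ∈ G n) :
    ι k x ∈ inducedGrading k G n :=
  Submodule.subset_span ⟨[(n, x)], by simpa using hx, by simp, by simp⟩

theorem algebraMap_mem_inducedFiltration (n : ℕ) (c : k) :
    algebraMap k _ c ∈ inducedFiltration k G n := by
  rw [Algebra.algebraMap_eq_smul_one]
  exact Submodule.smul_mem _ _ (Submodule.subset_span ⟨[], by simp, by simp, by simp⟩)

theorem algebraMap_mem_inducedGrading (c : k) :
    algebraMap k _ c ∈ inducedGrading k G 0 := by
  rw [Algebra.algebraMap_eq_smul_one]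
  exact Submodule.smul_mem _ _ (Submodule.subset_span ⟨[], by simp, by simp, by simp⟩)

end UniversalEnvelopingAlgebra

/-! ### The filtered and graded cases -/

theorem mainTheorem3 {k : Type*} [Field k] [CharZero k] {U : Type*} [Ring U] [HopfAlgebra k U]
    [Coalgebra.IsCocomm k U] :
    -- the filtered case
    (∀ F : ℕ → Submodule k U,
      HopfAlgebra.IsFiltered k F → Module.finrank k (F 0) = 1 →
      HopfAlgebra.IsFiltered k
        (UniversalEnvelopingAlgebra.inducedFiltration k (HopfAlgebra.primitivePart k F)) ∧
      ∃ e : UniversalEnvelopingAlgebra k (HopfAlgebra.primitives k U) ≃ₐc[k] U,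
        (∀ x : HopfAlgebra.primitives k U, e (UniversalEnvelopingAlgebra.ι k x) = (x : U)) ∧
        (∀ a, e (HopfAlgebra.antipode k a) = HopfAlgebra.antipode k (e a)) ∧
        (∀ n a, e a ∈ F n ↔
          a ∈ UniversalEnvelopingAlgebra.inducedFiltration k (HopfAlgebra.primitivePart k F) n)) ∧
    -- the graded case
    (∀ 𝒜 : ℕ → Submodule k U,
      HopfAlgebra.IsGraded k 𝒜 → Module.finrank k (𝒜 0) = 1 →
      HopfAlgebra.IsGraded k
        (UniversalEnvelopingAlgebra.inducedGrading k (HopfAlgebra.primitivePart k 𝒜)) ∧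
      ∃ e : UniversalEnvelopingAlgebra k (HopfAlgebra.primitives k U) ≃ₐc[k] U,
        (∀ x : HopfAlgebra.primitives k U, e (UniversalEnvelopingAlgebra.ι k x) = (x : U)) ∧
        (∀ a, e (HopfAlgebra.antipode k a) = HopfAlgebra.antipode k (e a)) ∧
        (∀ n a, e a ∈ 𝒜 n ↔
          a ∈ UniversalEnvelopingAlgebra.inducedGrading k (HopfAlgebra.primitivePart k 𝒜) n)) := by

  refine ⟨fun F hF h0 => ?_, fun 𝒜 h𝒜 h0 => ?_⟩
  · have h1 := (HopfAlgebra.one_mem_and_algebraMap_counit_of_finrank_zero k h0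
      hF.mul_mem hF.comul_mem).1
    obtain ⟨e, hι, hS, he⟩ := HopfAlgebra.exists_equiv_of_isConnectedFamily
      (hF.isConnectedFamily k h0)
      (UniversalEnvelopingAlgebra.inducedFiltration k (HopfAlgebra.primitivePart k F))
      (UniversalEnvelopingAlgebra.inducedFiltration_mul_mem k _)
      (fun n x hx => UniversalEnvelopingAlgebra.ι_mem_inducedFiltration k _ hx)
      (fun n x _ => UniversalEnvelopingAlgebra.algebraMap_mem_inducedFiltration k _ n _)
      (fun n a ha => by
        suffices hle : UniversalEnvelopingAlgebra.inducedFiltration k (HopfAlgebra.primitivePart k F) n ≤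
            (F n).comap (HopfAlgebra.primitivesLiftAlgHom k U).toLinearMap from hle ha
        refine Submodule.span_le.mpr ?_
        rintro _ ⟨l, hl, hs, rfl⟩
        exact hF.mono hs (HopfAlgebra.primitivesLift_prod_mem k h1 hF.mul_mem l hl))
    exact ⟨hF.of_equiv k e hS he, e, hι, hS, he⟩
  · have h1 := (HopfAlgebra.one_mem_and_algebraMap_counit_of_finrank_zero k h0
      h𝒜.mul_mem h𝒜.comul_mem).1
    obtain ⟨e, hι, hS, he⟩ := HopfAlgebra.exists_equiv_of_isConnectedFamily
      (h𝒜.isConnectedFamily k h0)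
      (UniversalEnvelopingAlgebra.inducedGrading k (HopfAlgebra.primitivePart k 𝒜))
      (UniversalEnvelopingAlgebra.inducedGrading_mul_mem k _)
      (fun n x hx => UniversalEnvelopingAlgebra.ι_mem_inducedGrading k _ hx)
      -- Unlike in the filtered case, scalars are only known to lie in degree 0, so the counit has
      -- to vanish in positive degrees.
      (fun n x hx => by
        rcases eq_or_ne n 0 with rfl | hn
        · exact UniversalEnvelopingAlgebra.algebraMap_mem_inducedGrading k _ _
        · rw [h𝒜.counit_eq_zero k h0 hn hx, map_zero]
          exact zero_mem _)
      (fun n a ha => by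
        suffices hle : UniversalEnvelopingAlgebra.inducedGrading k (HopfAlgebra.primitivePart k 𝒜) n ≤
            (𝒜 n).comap (HopfAlgebra.primitivesLiftAlgHom k U).toLinearMap from hle ha
        refine Submodule.span_le.mpr ?_
        rintro _ ⟨l, hl, rfl, rfl⟩
        exact HopfAlgebra.primitivesLift_prod_mem k h1 h𝒜.mul_mem l hl)
    exact ⟨h𝒜.of_equiv k e he, e, hι, hS, he⟩
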